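/- **Conventions.** For \(\pi=\pi_1\cdots\pi_n\in S_n\), an inversion is a pair \(i<j\) with \(\pi_i>\pi_j\), and \(\mathrm{inv}(\pi)\) is the number of inversions. A permutation avoids a set \(B\) of patterns if it has no subsequence order-isomorphic to an element of \(B\); it is indecomposable if it is nonempty and is not a direct sum of two nonempty permutations. Let \(I_k(B)\) be the set of indecomposable \(B\)-avoiding permutations (of any length) with exactly \(k\) inversions, and let \(\mathrm{av}_n^k(B)\) be the number of \(B\)-avoiding permutations in \(S_n\) with exactly \(k\) inversions. If for every \(k\) the value \(\mathrm{av}_n^k(B)\) equals a constant \(c_k(B)\) for all sufficiently large \(n\), we say that \(B\) has a limit sequence, and its limit generating function is \(C_B(x)=\sum_{k\ge 0}c_k(B)x^k\). For a \(132\)-avoiding permutation \(\pi\), let \(\Lambda(\pi)\) be the integer partition obtained by deleting the trailing zeros of the inversion table \((b_1,\dots,b_n)\), where \(b_i=|\{j>i:\pi_i>\pi_j\}|\) (for \(132\)-avoiders this table is weakly decreasing). The sand pile model \(\mathrm{SPM}(k)\) is the smallest set of partitions of \(k\) that contains \((k)\) (the empty partition if \(k=0\)) and contains, with each \(\lambda\),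 every partition obtained from \(\lambda\) by subtracting one from a part and adding one to the next part (the part following the last one being \(0\)). **Proposition.** For every \(k\ge 0\), the map \(\Lambda\) restricts to a bijection from \(I_k(132,2341)\) onto \(\mathrm{SPM}(k)\). Moreover, the sets \(\{132,2341\}\) and \(\{1324,2341\}\) have limit sequences, and, as formal power series, \[ C_{132,2341}(x)=1+\sum_{k\ge 1}x^{k(k+1)/2}\prod_{i=1}^{k}\left(x+\frac{1}{1-x^i}\right), \qquad C_{1324,2341}(x)=\left(1+\sum_{k\ge 1}x^{k(k+1)/2}\prod_{i=1}^{k}\left(x+\frac{1}{1-x^i}\right)\right)^{2}. \] -/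

import Mathlib

open scoped PowerSeries.WithPiTopology

namespace PermPattern

/-- Permutations of arbitrary length: `⟨n, π⟩` is `π ∈ S_n`, with positions and values
numbered `0, …, n - 1` instead of `1, …, n`. -/
abbrev AnyPerm : Type := Σ n : ℕ, Equiv.Perm (Fin n)

/-- `π` contains `p`: some subsequence of `π` is order-isomorphic to `p`. -/
def Contains {n m : ℕ} (π : Equiv.Perm (Fin n)) (p : Equiv.Perm (Fin m)) : Prop :=
  ∃ f : Fin m ↪o Fin n, ∀ i j : Fin m, π (f i) < π (f j) ↔ p i < p j

/-- `π` avoids every pattern in the set `B`. -/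
def Avoids {n : ℕ} (π : Equiv.Perm (Fin n)) (B : Set AnyPerm) : Prop :=
  ∀ p ∈ B, ¬ Contains π p.2

/-- The number of inversions: pairs of positions `i < j` with `π i > π j`. -/
def inv {n : ℕ} (π : Equiv.Perm (Fin n)) : ℕ :=
  (Finset.univ.filter fun q : Fin n × Fin n => q.1 < q.2 ∧ π q.2 < π q.1).card

/-- The direct sum `σ ⊕ τ`: `σ` on the first `|σ|` positions and values,
`τ` shifted by `|σ|` on the remaining ones. -/
def directSum (σ τ : AnyPerm) : AnyPerm :=
  ⟨σ.1 + τ.1, finSumFinEquiv.permCongr (Equiv.sumCongr σ.2 τ.2)⟩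

/-- `π` has exactly one component: it is nonempty and is not the direct sum of two
nonempty permutations. -/
def Indecomposable (π : AnyPerm) : Prop :=
  π.1 ≠ 0 ∧ ∀ σ τ : AnyPerm, π = directSum σ τ → σ.1 = 0 ∨ τ.1 = 0

/-- `I_k(B)`: the indecomposable `B`-avoiders (of any length) with exactly `k` inversions. -/
def indecomposableAvoiders (B : Set AnyPerm) (k : ℕ) : Set AnyPerm :=
  {π | Indecomposable π ∧ Avoids π.2 B ∧ inv π.2 = k}

/-- `av_n^k(B)`: the number of `B`-avoiders of length `n` with exactly `k` inversions. -/
noncomputable def av (B : Set AnyPerm) (n k : ℕ) : ℕ :=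
  {π : Equiv.Perm (Fin n) | Avoids π B ∧ inv π = k}.ncard

/-- `c` is the limit sequence of `B`: for every `k`, `av_n^k(B) = c k` for all large `n`. -/
def IsLimitSequence (B : Set AnyPerm) (c : ℕ → ℕ) : Prop :=
  ∀ k, ∃ m, ∀ n, m ≤ n → av B n k = c k

/-- `B` has a limit sequence `c`, and `F = ∑ c_k x^k` is its limit generating function `C_B`. -/
def IsLimitGenFun (B : Set AnyPerm) (F : PowerSeries ℚ) : Prop :=
  ∃ c : ℕ → ℕ, IsLimitSequence B c ∧ F = PowerSeries.mk fun k => (c k : ℚ)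

/-- The entry of the inversion table (Lehmer code) of `π` at position `i`: the number of later
positions with a smaller value. -/
def lehmer {n : ℕ} (π : Equiv.Perm (Fin n)) (i : Fin n) : ℕ :=
  (Finset.univ.filter fun j : Fin n => i < j ∧ π j < π i).card

/-- The sequence `λ` (indexed from `0`, and continued by zeros after its last part) is a
partition of `k`: it is weakly decreasing and its entries sum to `k`. -/
def IsPartitionOf (l : ℕ →₀ ℕ) (k : ℕ) : Prop :=
  Antitone l ∧ (l.sum fun _ a => a) = k

/-- `Λ(π)`: the inversion table of `π`, with trailing zeros disregarded (as partitions are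
represented by sequences continued by zeros). -/
noncomputable def Lam (π : AnyPerm) : ℕ →₀ ℕ :=
  Finsupp.onFinset (Finset.range π.1)
    (fun i => if h : i < π.1 then lehmer π.2 ⟨i, h⟩ else 0)
    (fun i hi => by
      by_contra hn
      rw [Finset.mem_range] at hn
      simp [hn] at hi)

/-- `μ` arises from `l` by subtracting one from a (positive) part and adding one to the next
part, where the part after the last one is `0`. -/
def SandMove (l μ : ℕ →₀ ℕ) : Prop :=
  ∃ i : ℕ, l i = μ i + 1 ∧ μ (i + 1) = l (i + 1) + 1 ∧
    ∀ j, j ≠ i → j ≠ i + 1 → μ j = l j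

/-- Membership in the sand pile model `SPM(k)`: it contains `(k)`, and every partition that
arises by a move from one of its elements. -/
inductive InSPM (k : ℕ) : (ℕ →₀ ℕ) → Prop
  | start : InSPM k (Finsupp.single 0 k)
  | move {l μ : ℕ →₀ ℕ} : InSPM k l → SandMove l μ → IsPartitionOf μ k → InSPM k μ

/-- The sand pile model `SPM(k)`. -/
def SPM (k : ℕ) : Set (ℕ →₀ ℕ) := {l | InSPM k l}

/-- The pattern `132`. -/
def p132 : AnyPerm := ⟨3, ⟨![0, 2, 1], ![0, 2, 1], by decide, by decide⟩⟩

/-- The pattern `1324`. -/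
def p1324 : AnyPerm := ⟨4, ⟨![0, 2, 1, 3], ![0, 2, 1, 3], by decide, by decide⟩⟩

/-- The pattern `2341`. -/
def p2341 : AnyPerm := ⟨4, ⟨![1, 2, 3, 0], ![3, 0, 1, 2], by decide, by decide⟩⟩

/-- The formal power series `x^{k(k+1)/2} ∏_{i=1}^k (x + 1/(1 - x^i))`. -/
noncomputable def spmTerm (k : ℕ) : PowerSeries ℚ :=
  PowerSeries.X ^ (k * (k + 1) / 2) *
    ∏ i ∈ Finset.Icc 1 k, (PowerSeries.X + (1 - PowerSeries.X ^ i)⁻¹)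

/-- The formal power series `1 + ∑_{k ≥ 1} x^{k(k+1)/2} ∏_{i=1}^k (x + 1/(1 - x^i))`
(the sum converges coefficientwise). -/
noncomputable def spmSeries : PowerSeries ℚ := 1 + ∑' k : ℕ, spmTerm (k + 1)

end PermPattern

namespace PermPattern

/-! Everything is read off the inversion table b. A permutation avoids 132 exactly when b is weakly
decreasing, and a 132-avoider avoids 2341 exactly when b_r + r ≤ b_p + p + 1 for all p < r with b_r
≥ 1 (`not_contains_p2341_iff`). These inequalities (`IsSandPile`) also describe the sand pile model:
moves preserve them, and any solution other than a single part arises by a move from another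
solution with smaller Σ i·l_i (`exists_sandMove`). The length of an indecomposable avoider can be
recovered from the table as 1 + max (b_i + i) over positive entries, or 1 if there are none; this
gives the bijection `bijOn_Lam`. In length n > k every sand pile of k is a table, so the count of
{132, 2341}-avoiders is already |SPM(k)|.

For the series, sand piles are sorted by k = min (l_p + p). Subtracting one from each entry of an
initial segment relates level k + 1 to itself and to level k, and the resulting linear equation
yields the k-th summand (`genFun_level`).

For {1324, 2341}, an avoider with k inversions and length at least 2k + 2 preserves its first k + 1
positions (`apply_lt_of_not_contains_p1324`), hence is α ⊕ β. It avoids both patterns exactly when α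
avoids {132, 2341} and β avoids {213, 2341}. The inverse of the reverse complement turns 213 into
132 and fixes 2341 and the inversion number, so both factors contribute the same series and the
limit is a square. -/

/-- The pattern `213`. -/
def p213 : AnyPerm := ⟨3, ⟨![1, 0, 2], ![1, 0, 2], by decide, by decide⟩⟩

/-! ### Pattern containment as inequalities between entries. -/

theorem contains_three_iff {n : ℕ} (π : Equiv.Perm (Fin n)) (p : Equiv.Perm (Fin 3)) :
    Contains π p ↔ ∃ a b c : Fin n, a < b ∧ b < c ∧
      ∀ i j : Fin 3, π (![a, b, c] i) < π (![a, b, c] j) ↔ p i < p j := by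
  constructor
  · rintro ⟨f, hf⟩
    have e : ![f 0, f 1, f 2] = f := by
      ext i; fin_cases i <;> rfl
    exact ⟨f 0, f 1, f 2, f.strictMono (by decide), f.strictMono (by decide), by rwa [e]⟩
  · rintro ⟨a, b, c, hab, hbc, h⟩
    refine ⟨OrderEmbedding.ofStrictMono ![a, b, c] ?_, h⟩
    rw [Fin.strictMono_iff_lt_succ]
    intro i
    fin_cases i <;> assumption

theorem contains_four_iff {n : ℕ} (π : Equiv.Perm (Fin n)) (p : Equiv.Perm (Fin 4)) :
    Contains π p ↔ ∃ a b c d : Fin n, a < b ∧ b < c ∧ c < d ∧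
      ∀ i j : Fin 4, π (![a, b, c, d] i) < π (![a, b, c, d] j) ↔ p i < p j := by
  constructor
  · rintro ⟨f, hf⟩
    have e : ![f 0, f 1, f 2, f 3] = f := by
      ext i; fin_cases i <;> rfl
    exact ⟨f 0, f 1, f 2, f 3, f.strictMono (by decide), f.strictMono (by decide),
      f.strictMono (by decide), by rwa [e]⟩
  · rintro ⟨a, b, c, d, hab, hbc, hcd, h⟩
    refine ⟨OrderEmbedding.ofStrictMono ![a, b, c, d] ?_, h⟩
    rw [Fin.strictMono_iff_lt_succ]
    intro i
    fin_cases i <;> assumption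

theorem contains_p132_iff {n : ℕ} (π : Equiv.Perm (Fin n)) :
    Contains π p132.2 ↔ ∃ a b c : Fin n, a < b ∧ b < c ∧ π a < π c ∧ π c < π b := by
  refine (contains_three_iff π _).trans ?_
  constructor
  · rintro ⟨a, b, c, hab, hbc, h⟩
    exact ⟨a, b, c, hab, hbc, (h 0 2).2 (by decide), (h 2 1).2 (by decide)⟩
  · rintro ⟨a, b, c, hab, hbc, h1, h2⟩
    refine ⟨a, b, c, hab, hbc, fun i j => ?_⟩
    fin_cases i <;> fin_cases j <;> simp [p132] <;> order

theorem contains_p213_iff {n : ℕ} (π : Equiv.Perm (Fin n)) :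
    Contains π p213.2 ↔ ∃ a b c : Fin n, a < b ∧ b < c ∧ π b < π a ∧ π a < π c := by
  refine (contains_three_iff π _).trans ?_
  constructor
  · rintro ⟨a, b, c, hab, hbc, h⟩
    exact ⟨a, b, c, hab, hbc, (h 1 0).2 (by decide), (h 0 2).2 (by decide)⟩
  · rintro ⟨a, b, c, hab, hbc, h1, h2⟩
    refine ⟨a, b, c, hab, hbc, fun i j => ?_⟩
    fin_cases i <;> fin_cases j <;> simp [p213] <;> order

theorem contains_p1324_iff {n : ℕ} (π : Equiv.Perm (Fin n)) :
    Contains π p1324.2 ↔ ∃ a b c d : Fin n, a < b ∧ b < c ∧ c < d ∧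
      π a < π c ∧ π c < π b ∧ π b < π d := by
  refine (contains_four_iff π _).trans ?_
  constructor
  · rintro ⟨a, b, c, d, hab, hbc, hcd, h⟩
    exact ⟨a, b, c, d, hab, hbc, hcd, (h 0 2).2 (by decide), (h 2 1).2 (by decide),
      (h 1 3).2 (by decide)⟩
  · rintro ⟨a, b, c, d, hab, hbc, hcd, h1, h2, h3⟩
    refine ⟨a, b, c, d, hab, hbc, hcd, fun i j => ?_⟩
    fin_cases i <;> fin_cases j <;> simp [p1324] <;> order

theorem contains_p2341_iff {n : ℕ} (π : Equiv.Perm (Fin n)) :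
    Contains π p2341.2 ↔ ∃ a b c d : Fin n, a < b ∧ b < c ∧ c < d ∧
      π d < π a ∧ π a < π b ∧ π b < π c := by
  refine (contains_four_iff π _).trans ?_
  constructor
  · rintro ⟨a, b, c, d, hab, hbc, hcd, h⟩
    exact ⟨a, b, c, d, hab, hbc, hcd, (h 3 0).2 (by decide), (h 0 1).2 (by decide),
      (h 1 2).2 (by decide)⟩
  · rintro ⟨a, b, c, d, hab, hbc, hcd, h1, h2, h3⟩
    refine ⟨a, b, c, d, hab, hbc, hcd, fun i j => ?_⟩
    fin_cases i <;> fin_cases j <;> simp [p2341] <;> order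

theorem avoids_pair_iff {n : ℕ} (π : Equiv.Perm (Fin n)) (p q : AnyPerm) :
    Avoids π {p, q} ↔ ¬ Contains π p.2 ∧ ¬ Contains π q.2 := by
  simp [Avoids]

/-! ### Inversion tables. -/

theorem inv_eq_sum_lehmer {n : ℕ} (π : Equiv.Perm (Fin n)) : inv π = ∑ i, lehmer π i := by
  classical
  rw [inv, Finset.card_eq_sum_card_fiberwise (f := Prod.fst) (t := Finset.univ)
    (fun _ _ => Finset.mem_univ _)]
  refine Finset.sum_congr rfl fun i _ => ?_
  rw [lehmer]
  refine (Finset.card_nbij' (fun j => (i, j)) Prod.snd ?_ ?_ ?_ ?_).symm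
  · intro j hj; simpa using hj
  · rintro ⟨a, b⟩ h
    simp only [Finset.coe_filter, Finset.mem_filter, Finset.mem_univ, true_and,
      Set.mem_ofPred_eq] at h ⊢
    obtain ⟨h, rfl⟩ := h
    exact h
  · intro j _; rfl
  · rintro ⟨a, b⟩ h
    simp only [Finset.coe_filter, Finset.mem_filter, Finset.mem_univ, true_and,
      Set.mem_ofPred_eq] at h ⊢
    rw [h.2]

theorem lehmer_add_lt {n : ℕ} (π : Equiv.Perm (Fin n)) (i : Fin n) : lehmer π i + i < n := by
  have h : lehmer π i ≤ (Finset.Ioi i).card :=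
    Finset.card_le_card fun j hj => by simp at hj ⊢; exact hj.1
  rw [Fin.card_Ioi] at h
  have := i.2
  omega

/-- At the first position where two permutations differ, the same values are still unused. The table
entry counts the unused values below the one chosen, so the smaller choice has the strictly smaller
entry. -/
theorem lehmer_injective (n : ℕ) :
    Function.Injective (lehmer : Equiv.Perm (Fin n) → Fin n → ℕ) := by
  have key : ∀ (π ρ : Equiv.Perm (Fin n)) (i : Fin n), (∀ j < i, π j = ρ j) → π i < ρ i →
      lehmer π i < lehmer ρ i := by
    intro π ρ i hlt hi
    have later : ∀ v : Fin n, i ≤ π.symm v ↔ i ≤ ρ.symm v := by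
      intro v
      rw [← not_lt, ← not_lt, not_iff_not]
      constructor
      · intro h
        have := hlt _ h
        rw [Equiv.apply_symm_apply] at this
        rwa [this, Equiv.symm_apply_apply, ← this] at *
      · intro h
        have := hlt _ h
        rw [Equiv.apply_symm_apply] at this
        rw [← this, Equiv.symm_apply_apply]
        exact h
    have card_eq : ∀ σ : Equiv.Perm (Fin n), lehmer σ i =
        (Finset.univ.filter fun v => i ≤ σ.symm v ∧ v < σ i).card := by
      intro σ
      refine Finset.card_nbij' σ σ.symm ?_ ?_ ?_ ?_
      · intro j hj
        simp only [Finset.coe_filter, Finset.mem_univ, true_and, Set.mem_ofPred_eq,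
          Equiv.symm_apply_apply] at hj ⊢
        exact ⟨hj.1.le, hj.2⟩
      · intro v hv
        simp only [Finset.coe_filter, Finset.mem_univ, true_and, Set.mem_ofPred_eq,
          Equiv.apply_symm_apply] at hv ⊢
        refine ⟨lt_of_le_of_ne hv.1 ?_, hv.2⟩
        intro h
        rw [h, Equiv.apply_symm_apply] at hv
        exact lt_irrefl _ hv.2
      · intro j _; simp
      · intro j _; simp
    rw [card_eq, card_eq]
    apply Finset.card_lt_card
    rw [Finset.ssubset_iff_of_subset]
    · refine ⟨π i, ?_, ?_⟩
      · simp [hi, ← later]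
      · simp
    · intro v hv
      simp only [Finset.mem_filter, Finset.mem_univ, true_and] at hv ⊢
      exact ⟨(later v).1 hv.1, hv.2.trans hi⟩
  intro π ρ h
  ext1 i
  induction i using WellFoundedLT.induction with
  | ind i ih =>
    rcases lt_trichotomy (π i) (ρ i) with hi | hi | hi
    · exact absurd (congrFun h i) (key π ρ i ih hi).ne
    · exact hi
    · exact absurd (congrFun h i) (key ρ π i (fun j hj => (ih j hj).symm) hi).ne'

/-- By counting: the injective table map goes into a product of n factors with n - i elements each,
which has n! elements. -/
theorem exists_lehmer_eq {n : ℕ} (b : Fin n → ℕ) (hb : ∀ i, b i + i < n) :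
    ∃ π : Equiv.Perm (Fin n), lehmer π = b := by
  let F : Equiv.Perm (Fin n) → (∀ i : Fin n, Fin (n - i)) :=
    fun π i => ⟨lehmer π i, by have := lehmer_add_lt π i; omega⟩
  have hinj : Function.Injective F := by
    intro π ρ h
    apply lehmer_injective
    ext i
    have := congrArg Fin.val (congrFun h i)
    exact this
  have hcard : Fintype.card (Equiv.Perm (Fin n)) = Fintype.card (∀ i : Fin n, Fin (n - i)) := by
    rw [Fintype.card_perm, Fintype.card_pi]
    simp only [Fintype.card_fin]
    rw [Fin.prod_univ_eq_prod_range (fun i => n - i) n, ← Nat.descFactorial_eq_prod_range,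
      Nat.descFactorial_self]
  obtain ⟨π, hπ⟩ := ((Fintype.bijective_iff_injective_and_card F).2 ⟨hinj, hcard⟩).2
    (fun i => ⟨b i, by have := hb i; omega⟩)
  refine ⟨π, ?_⟩
  ext i
  exact congrArg Fin.val (congrFun hπ i)


/-! ### Avoidance of 132 and 2341 in terms of the inversion table. -/

theorem lehmer_pos_iff {n : ℕ} (π : Equiv.Perm (Fin n)) (i : Fin n) :
    1 ≤ lehmer π i ↔ ∃ j, i < j ∧ π j < π i := by
  rw [lehmer, Nat.one_le_iff_ne_zero, ← Nat.pos_iff_ne_zero, Finset.card_pos]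
  simp [Finset.Nonempty]

/-- For i < j, an entry after j that is below π j must be below π i too, since otherwise it
completes a 132 with i and j. -/
theorem antitone_lehmer_of_not_contains {n : ℕ} {π : Equiv.Perm (Fin n)}
    (h : ¬ Contains π p132.2) : Antitone (lehmer π) := by
  rw [contains_p132_iff] at h
  push Not at h
  intro i j hij
  rcases hij.eq_or_lt with rfl | hij
  · exact le_rfl
  refine Finset.card_le_card fun m hm => ?_
  simp only [Finset.mem_filter, Finset.mem_univ, true_and] at hm ⊢
  refine ⟨hij.trans hm.1, ?_⟩
  by_contra hlt
  rcases (not_lt.1 hlt).eq_or_lt with h1 | h1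
  · exact (hij.trans hm.1).ne (π.injective h1)
  · exact absurd hm.2 (not_lt.2 (h i j m hij hm.1 h1))

theorem not_contains_of_antitone_lehmer {n : ℕ} {π : Equiv.Perm (Fin n)}
    (h : Antitone (lehmer π)) : ¬ Contains π p132.2 := by
  rw [contains_p132_iff]
  rintro ⟨i, j, k, hij, hjk, h1, h2⟩
  -- An entry strictly between i and j can replace j or i, according to whether it exceeds π k. So
  -- the ascent may be taken at adjacent positions, where the table strictly increases because of k.
  induction hd : (j : ℕ) - i using Nat.strong_induction_on generalizing i j with
  | _ d ih =>
    by_cases hm : ∃ m, i < m ∧ m < j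
    · obtain ⟨m, him, hmj⟩ := hm
      rcases lt_trichotomy (π m) (π k) with hmk | hmk | hmk
      · exact ih (j - m) (by omega) m j hmj hjk hmk h2 rfl
      · exact absurd (π.injective hmk) (hmj.trans hjk).ne
      · exact ih (m - i) (by omega) i m him (hmj.trans hjk) h1 hmk rfl
    · push Not at hm
      refine absurd (h hij.le) (not_le.2 (Finset.card_lt_card ?_))
      rw [Finset.ssubset_iff_of_subset]
      · exact ⟨k, by simp [hjk, h2], by simp [h1.le]⟩
      · intro m hmem
        simp only [Finset.mem_filter, Finset.mem_univ, true_and] at hmem ⊢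
        have hlt : π m < π j := hmem.2.trans (h1.trans h2)
        exact ⟨lt_of_le_of_ne (hm m hmem.1) (by rintro rfl; exact lt_irrefl _ hlt), hlt⟩

/-- Entries in the window `(p, r]` exceeding `π p`, against the inversion table. -/
theorem card_window_add {n : ℕ} (π : Equiv.Perm (Fin n)) {p r : Fin n} (hpr : p < r) :
    ((Finset.Ioc p r).filter fun m => π p < π m).card + lehmer π p + p =
      (Finset.univ.filter fun m => r < m ∧ π m < π p).card + r := by
  have h1 : ((Finset.Ioc p r).filter fun m => π p < π m).card +
      ((Finset.Ioc p r).filter fun m => ¬ π p < π m).card = r - p := by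
    rw [Finset.card_filter_add_card_filter_not, Fin.card_Ioc]
  have h2 : lehmer π p = ((Finset.Ioc p r).filter fun m => ¬ π p < π m).card +
      (Finset.univ.filter fun m => r < m ∧ π m < π p).card := by
    rw [lehmer, ← Finset.card_union_of_disjoint]
    · congr 1
      ext m
      simp only [Finset.mem_filter, Finset.mem_univ, true_and, Finset.mem_union, Finset.mem_Ioc]
      constructor
      · rintro ⟨h, h'⟩
        rcases le_or_gt m r with hm | hm
        · exact Or.inl ⟨⟨h, hm⟩, h'.le.not_gt⟩
        · exact Or.inr ⟨hm, h'⟩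
      · rintro (⟨⟨h, -⟩, h'⟩ | ⟨h, h'⟩)
        · refine ⟨h, lt_of_le_of_ne (not_lt.1 h') fun e => h.ne' (π.injective e)⟩
        · exact ⟨hpr.trans h, h'⟩
    · rw [Finset.disjoint_left]
      intro m hm hm'
      simp only [Finset.mem_filter, Finset.mem_univ, true_and, Finset.mem_Ioc] at hm hm'
      exact absurd hm.1.2 (not_le.2 hm'.1)
  have : (p : ℕ) < r := hpr
  omega

/-- In a 132-avoider the entries after p that exceed π p increase. By `card_window_add`, a violated
inequality puts two of them in (p, r]; with p they play 2, 3, 4, and an entry after r below π r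
plays 1. -/
theorem not_contains_p2341_iff {n : ℕ} {π : Equiv.Perm (Fin n)} (h : ¬ Contains π p132.2) :
    ¬ Contains π p2341.2 ↔
      ∀ p r : Fin n, p < r → 1 ≤ lehmer π r → lehmer π r + r ≤ lehmer π p + p + 1 := by
  rw [contains_p132_iff] at h
  push Not at h
  have up : ∀ {a b c : Fin n}, a < b → b < c → π a < π b → π c < π b → π c < π a := by
    intro a b c hab hbc h1 h2
    refine lt_of_le_of_ne ?_ fun e => (hab.trans hbc).ne' (π.injective e)
    by_contra h3
    exact absurd h2 (not_lt.2 (h a b c hab hbc (not_le.1 h3)))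
  rw [contains_p2341_iff]
  constructor
  · intro hc p r hpr hr
    by_contra hlt
    have hw := card_window_add π hpr
    have hle : lehmer π r ≤
        (Finset.univ.filter fun m => r < m ∧ π m < π p).card := by
      refine Finset.card_le_card fun m hm => ?_
      simp only [Finset.mem_filter, Finset.mem_univ, true_and] at hm ⊢
      refine ⟨hm.1, ?_⟩
      rcases lt_or_gt_of_ne (π.injective.ne hpr.ne) with h1 | h1
      · exact up hpr hm.1 h1 hm.2
      · exact hm.2.trans h1
    have h2 : 1 < ((Finset.Ioc p r).filter fun m => π p < π m).card := by omega
    obtain ⟨a, ha, b, hb, hab⟩ := Finset.one_lt_card.1 h2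
    simp only [Finset.mem_filter, Finset.mem_Ioc] at ha hb
    obtain ⟨l, hl1, hl2⟩ := (lehmer_pos_iff π r).1 hr
    have main : ∀ a b : Fin n, p < a → a < b → b ≤ r → π p < π a → π p < π b → False := by
      intro a b hpa hab' hbr h1 h2
      have hinc : π a < π b := by
        by_contra h3
        have : π b < π a :=
          lt_of_le_of_ne (not_lt.1 h3) fun e => hab'.ne' (π.injective e)
        exact absurd h2 (up hpa hab' h1 this).not_gt
      rcases lt_or_gt_of_ne (π.injective.ne hpr.ne) with h4 | h4
      · exact hc ⟨p, a, b, l, hpa, hab', hbr.trans_lt hl1, up hpr hl1 h4 hl2, h1, hinc⟩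
      · exact hc ⟨p, a, b, l, hpa, hab', hbr.trans_lt hl1, hl2.trans h4, h1, hinc⟩
    rcases lt_or_gt_of_ne hab with h3 | h3
    · exact main a b ha.1.1 h3 hb.1.2 ha.2 hb.2
    · exact main b a hb.1.1 h3 ha.1.2 hb.2 ha.2
  · rintro hg ⟨a, b, c, d, hab, hbc, hcd, h1, h2, h3⟩
    have hr : 1 ≤ lehmer π c := (lehmer_pos_iff π c).2 ⟨d, hcd, h1.trans (h2.trans h3)⟩
    have hg' := hg a c (hab.trans hbc) hr
    have hw := card_window_add π (hab.trans hbc)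
    have hle : (Finset.univ.filter fun m => c < m ∧ π m < π a).card ≤ lehmer π c := by
      refine Finset.card_le_card fun m hm => ?_
      simp only [Finset.mem_filter, Finset.mem_univ, true_and] at hm ⊢
      exact ⟨hm.1, hm.2.trans (h2.trans h3)⟩
    have : 1 < ((Finset.Ioc a c).filter fun m => π a < π m).card := by
      rw [Finset.one_lt_card]
      exact ⟨b, by simp [hab, hbc.le, h2], c, by simp [hab.trans hbc, h2.trans h3], hbc.ne⟩
    omega

/-! ### The map Λ and the sand pile inequalities. -/

/-- The condition on a partition that characterizes the sand pile model. -/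
def IsSandPile (l : ℕ →₀ ℕ) : Prop :=
  Antitone l ∧ ∀ p r, p < r → 1 ≤ l r → l r + r ≤ l p + p + 1

theorem Lam_apply {n : ℕ} (π : Equiv.Perm (Fin n)) (i : Fin n) :
    Lam ⟨n, π⟩ i = lehmer π i := by
  simp [Lam]

theorem Lam_apply_of_le {n : ℕ} (π : Equiv.Perm (Fin n)) {i : ℕ} (h : n ≤ i) :
    Lam ⟨n, π⟩ i = 0 := by
  simp [Lam, h]

theorem Lam_add_lt {n : ℕ} (π : Equiv.Perm (Fin n)) {i : ℕ} (h : 1 ≤ Lam ⟨n, π⟩ i) :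
    Lam ⟨n, π⟩ i + i < n := by
  rcases lt_or_ge i n with hi | hi
  · rw [show Lam ⟨n, π⟩ i = _ from Lam_apply π ⟨i, hi⟩]
    exact lehmer_add_lt π ⟨i, hi⟩
  · rw [Lam_apply_of_le π hi] at h
    omega

theorem avoids_iff_isSandPile {n : ℕ} (π : Equiv.Perm (Fin n)) :
    Avoids π {p132, p2341} ↔ IsSandPile (Lam ⟨n, π⟩) := by
  rw [avoids_pair_iff]
  constructor
  · rintro ⟨h, h'⟩
    rw [not_contains_p2341_iff h] at h'
    refine ⟨fun i j hij => ?_, fun p r hpr hr => ?_⟩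
    · rcases lt_or_ge j n with hj | hj
      · have := antitone_lehmer_of_not_contains h
          (show (⟨i, hij.trans_lt hj⟩ : Fin n) ≤ ⟨j, hj⟩ from hij)
        rwa [← Lam_apply, ← Lam_apply] at this
      · rw [Lam_apply_of_le π hj]; exact Nat.zero_le _
    · have hr' : r < n := by have := Lam_add_lt π hr; omega
      rw [show Lam ⟨n, π⟩ r = _ from Lam_apply π ⟨r, hr'⟩] at hr ⊢
      rw [show Lam ⟨n, π⟩ p = _ from Lam_apply π ⟨p, hpr.trans hr'⟩]
      exact h' ⟨p, hpr.trans hr'⟩ ⟨r, hr'⟩ hpr hr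
  · rintro ⟨h, h'⟩
    have h132 : ¬ Contains π p132.2 := by
      refine not_contains_of_antitone_lehmer fun i j hij => ?_
      rw [← Lam_apply, ← Lam_apply]
      exact h hij
    refine ⟨h132, (not_contains_p2341_iff h132).2 fun p r hpr hr => ?_⟩
    rw [← Lam_apply] at hr
    rw [← Lam_apply, ← Lam_apply]
    exact h' p r hpr hr

theorem sum_Lam {n : ℕ} (π : Equiv.Perm (Fin n)) : ((Lam ⟨n, π⟩).sum fun _ a => a) = inv π := by
  rw [inv_eq_sum_lehmer, Finsupp.sum_of_support_subset (s := Finset.range n)]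
  · rw [Finset.sum_range]
    exact Finset.sum_congr rfl fun i _ => Lam_apply π i
  · exact Finsupp.support_onFinset_subset
  · simp

theorem Lam_mk_injective (n : ℕ) :
    Function.Injective fun π : Equiv.Perm (Fin n) => Lam ⟨n, π⟩ := by
  intro π ρ h
  apply lehmer_injective
  ext i
  rw [← Lam_apply, ← Lam_apply]
  exact DFunLike.congr_fun h (i : ℕ)

theorem exists_Lam_eq {n : ℕ} {l : ℕ →₀ ℕ} (h : ∀ i, 1 ≤ l i → l i + i < n) :
    ∃ π : Equiv.Perm (Fin n), Lam ⟨n, π⟩ = l := by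
  obtain ⟨π, hπ⟩ := exists_lehmer_eq (n := n) (fun i => l i) fun i => by
    have := h i
    have := i.2
    omega
  refine ⟨π, ?_⟩
  ext i
  rcases lt_or_ge i n with hi | hi
  · rw [show Lam ⟨n, π⟩ i = _ from Lam_apply π ⟨i, hi⟩, hπ]
  · rw [Lam_apply_of_le π hi]
    have := h i
    omega


/-! ### The sand pile model is the solution set of the inequalities. -/

theorem isSandPile_of_inSPM {k : ℕ} {l : ℕ →₀ ℕ} (h : InSPM k l) :
    IsSandPile l ∧ (l.sum fun _ a => a) = k := by
  induction h with
  | start =>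
    refine ⟨⟨fun i j hij => ?_, fun p r hpr hr => ?_⟩, by simp⟩
    · rcases Nat.eq_zero_or_pos i with rfl | hi
      · rcases Nat.eq_zero_or_pos j with rfl | hj
        · exact le_rfl
        · simp [hj.ne]
      · simp [Finsupp.single_apply, (hi.trans_le hij).ne]
    · rw [Finsupp.single_apply, if_neg (by omega)] at hr
      omega
  | @move l μ _ hm hμ ih =>
    obtain ⟨i, hi, hi1, hj⟩ := hm
    obtain ⟨⟨hl, hg⟩, -⟩ := ih
    refine ⟨⟨hμ.1, fun p r hpr hr => ?_⟩, hμ.2⟩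
    have hanti := hμ.1
    -- The raised entry: p = i is monotonicity of μ, and p < i follows from the pair (p, i) of l
    -- because μ (i + 1) + (i + 1) ≤ l i + i.
    by_cases hr1 : r = i + 1
    · subst hr1
      have h1 := hanti (show i ≤ i + 1 by omega)
      by_cases hpi : p = i
      · subst hpi; omega
      · have h2 := hg p i (by omega) (by omega)
        rw [hj p hpi (by omega)]
        omega
    · by_cases hri : r = i
      · subst hri
        have := hg p r hpr (by omega)
        rw [hj p (by omega) (by omega)]
        omega
      · have hr' := hj r hri hr1
        rw [hr'] at hr ⊢
        -- The lowered entry: the bound comes from the pair (i + 1, r) of l, as l (i + 1) + 1 = μ (i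
        -- + 1) ≤ μ i.
        by_cases hpi : p = i
        · subst hpi
          have h1 := hg (p + 1) r (by omega) hr
          have h2 := hanti (show p ≤ p + 1 by omega)
          omega
        · have h1 := hg p r hpr hr
          have : l p ≤ μ p := by
            by_cases hp1 : p = i + 1
            · subst hp1; omega
            · exact (hj p hpi hp1).ge
          omega

/-- A sand pile other than a single column has a position that can be undone. -/
theorem exists_undo_position {μ : ℕ →₀ ℕ} (h : IsSandPile μ) (h1 : 1 ≤ μ 1) :
    ∃ i, 1 ≤ μ (i + 1) ∧ (∀ p < i, μ i + i ≤ μ p + p) ∧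
      ∀ r, i + 1 < r → 1 ≤ μ r → μ r + r ≤ μ (i + 1) + (i + 1) := by
  -- At a plateau the sand pile inequalities through i + 1 and i are exactly the two bounds. Without
  -- a plateau the positive parts strictly decrease, so μ r + r is weakly decreasing on them and i =
  -- 0 works.
  by_cases hp : ∃ i, 1 ≤ μ (i + 1) ∧ μ i = μ (i + 1)
  · obtain ⟨i, hi, he⟩ := hp
    refine ⟨i, hi, fun p hpi => ?_, fun r hr hr1 => ?_⟩
    · have := h.2 p (i + 1) (by omega) hi
      omega
    · have := h.2 i r (by omega) hr1
      omega
  · push Not at hp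
    refine ⟨0, h1, by simp, fun r hr => ?_⟩
    induction r, hr using Nat.le_induction with
    | base =>
      intro h2
      have := hp 1 h2
      have := h.1 (show 1 ≤ 1 + 1 by omega)
      simp only [zero_add, Nat.succ_eq_add_one] at *
      omega
    | succ r hr ih =>
      intro h2
      have h3 := h.1 (show r ≤ r + 1 by omega)
      have := ih (by omega)
      have := hp r h2
      omega

theorem sum_eq_sum_range {l : ℕ →₀ ℕ} {N : ℕ} (h : ∀ i, N ≤ i → l i = 0) (f : ℕ → ℕ → ℕ)
    (hf : ∀ i, f i 0 = 0) : l.sum f = ∑ i ∈ Finset.range N, f i (l i) := by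
  refine Finsupp.sum_of_support_subset _ (fun i hi => ?_) _ fun i _ => hf i
  rw [Finset.mem_range]
  by_contra hN
  exact Finsupp.mem_support_iff.1 hi (h i (not_lt.1 hN))

/-- A grain is moved back from i + 1 to i. The bounds of `exists_undo_position` have no slack term +
1, which leaves room for the taller entry i and the shorter entry i + 1. The weighted sum drops by
one and serves as the induction measure. -/
theorem exists_sandMove {μ : ℕ →₀ ℕ} (h : IsSandPile μ) (h1 : 1 ≤ μ 1) :
    ∃ l : ℕ →₀ ℕ, IsSandPile l ∧ SandMove l μ ∧
      (l.sum fun _ a => a) = (μ.sum fun _ a => a) ∧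
      (l.sum fun i a => i * a) < μ.sum fun i a => i * a := by
  obtain ⟨i, hi, hlow, hhigh⟩ := exists_undo_position h h1
  have hi0 : 1 ≤ μ i := hi.trans (h.1 (Nat.le_succ i))
  let ν : ℕ →₀ ℕ := μ - Finsupp.single (i + 1) 1
  have hμ : μ = ν + Finsupp.single (i + 1) 1 := by
    refine (tsub_add_cancel_of_le ?_).symm
    rwa [Finsupp.single_le_iff]
  have hνi : ν i = μ i := by simp [ν]
  have hνi1 : ν (i + 1) + 1 = μ (i + 1) := by simp [ν]; omega
  have hνj : ∀ j, j ≠ i + 1 → ν j = μ j := by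
    intro j hj
    simp [ν, hj.symm]
  let l : ℕ →₀ ℕ := ν + Finsupp.single i 1
  have hli : l i = μ i + 1 := by simp [l, hνi]
  have hli1 : μ (i + 1) = l (i + 1) + 1 := by simp [l, hνi1]
  have hlj : ∀ j, j ≠ i → j ≠ i + 1 → μ j = l j := by
    intro j hj hj1
    simp [l, hj.symm, hνj j hj1]
  refine ⟨l, ⟨?_, ?_⟩, ⟨i, hli, hli1, hlj⟩, ?_, ?_⟩
  · refine antitone_nat_of_succ_le fun j => ?_
    have hj := h.1 (Nat.le_succ j)
    simp only [Nat.succ_eq_add_one] at hj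
    by_cases e1 : j = i
    · subst e1; omega
    by_cases e2 : j = i + 1
    · subst e2
      rw [← hlj (i + 1 + 1) (by omega) (by omega)]
      by_cases hz : 1 ≤ μ (i + 1 + 1)
      · have := hhigh (i + 1 + 1) (by omega) hz
        omega
      · omega
    by_cases e3 : j + 1 = i
    · have := hlow j (by omega)
      rw [← hlj j e1 e2]
      subst e3
      omega
    · rw [← hlj j e1 e2, ← hlj (j + 1) e3 (by omega)]
      exact hj
  · intro p r hpr hr
    by_cases r1 : r = i
    · subst r1
      have := hlow p hpr
      rw [← hlj p (by omega) (by omega)]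
      omega
    have hlr : l r ≤ μ r := by
      by_cases r2 : r = i + 1
      · subst r2; omega
      · exact (hlj r r1 r2).ge
    by_cases p1 : p = i + 1
    · subst p1
      have := hhigh r hpr (by omega)
      omega
    · have := h.2 p r hpr (by omega)
      have : μ p ≤ l p := by
        by_cases p2 : p = i
        · subst p2; omega
        · exact (hlj p p2 p1).le
      omega
  · rw [hμ]
    simp only [l]
    rw [Finsupp.sum_add_index' (by simp) (by simp), Finsupp.sum_add_index' (by simp) (by simp)]
    simp
  · conv_rhs => rw [hμ]
    simp only [l]
    rw [Finsupp.sum_add_index' (by simp) (by intros; ring),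
      Finsupp.sum_add_index' (by simp) (by intros; ring)]
    simp

theorem inSPM_of_isSandPile {k : ℕ} {l : ℕ →₀ ℕ} (h : IsSandPile l)
    (hk : (l.sum fun _ a => a) = k) : InSPM k l := by
  induction hw : (l.sum fun i a => i * a) using Nat.strong_induction_on generalizing l with
  | _ w ih =>
    by_cases h1 : 1 ≤ l 1
    · obtain ⟨l', hl', hm, hs, hlt⟩ := exists_sandMove h h1
      exact InSPM.move (ih _ (hw ▸ hlt) hl' (hs.trans hk) rfl) hm ⟨h.1, hk⟩
    · have hz : ∀ i, 1 ≤ i → l i = 0 := fun i hi => by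
        have := h.1 hi
        omega
      have hl : l = Finsupp.single 0 k := by
        rw [sum_eq_sum_range hz _ (by simp), Finset.sum_range_one] at hk
        ext i
        rcases Nat.eq_zero_or_pos i with rfl | hi
        · simp [hk]
        · rw [hz i hi, Finsupp.single_apply, if_neg hi.ne]
      rw [hl]
      exact InSPM.start

theorem mem_SPM_iff {k : ℕ} {l : ℕ →₀ ℕ} :
    l ∈ SPM k ↔ IsSandPile l ∧ (l.sum fun _ a => a) = k :=
  ⟨isSandPile_of_inSPM, fun h => inSPM_of_isSandPile h.1 h.2⟩

/-! ### Indecomposability -/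

/-- The direct sum of permutations of given lengths. -/
def sumPerm {a b : ℕ} (α : Equiv.Perm (Fin a)) (β : Equiv.Perm (Fin b)) :
    Equiv.Perm (Fin (a + b)) :=
  finSumFinEquiv.permCongr (Equiv.sumCongr α β)

theorem sumPerm_castAdd {a b : ℕ} (α : Equiv.Perm (Fin a)) (β : Equiv.Perm (Fin b)) (i : Fin a) :
    sumPerm α β (Fin.castAdd b i) = Fin.castAdd b (α i) := by
  simp [sumPerm, Equiv.permCongr_apply]

theorem sumPerm_natAdd {a b : ℕ} (α : Equiv.Perm (Fin a)) (β : Equiv.Perm (Fin b)) (i : Fin b) :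
    sumPerm α β (Fin.natAdd a i) = Fin.natAdd a (β i) := by
  simp [sumPerm, Equiv.permCongr_apply]

/-- A permutation preserving an initial segment of positions is a direct sum. -/
theorem exists_eq_sumPerm {a b : ℕ} (π : Equiv.Perm (Fin (a + b)))
    (h : ∀ i : Fin (a + b), (i : ℕ) < a → (π i : ℕ) < a) :
    ∃ (α : Equiv.Perm (Fin a)) (β : Equiv.Perm (Fin b)),
      π = sumPerm α β := by
  let e : Equiv.Perm (Fin a ⊕ Fin b) := finSumFinEquiv.symm.permCongr π
  have he : Set.MapsTo e (Set.range Sum.inl) (Set.range Sum.inl) := by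
    rintro _ ⟨x, rfl⟩
    have hx := h (Fin.castAdd b x) x.2
    refine ⟨⟨_, hx⟩, ?_⟩
    apply finSumFinEquiv.injective
    ext
    simp [e, Equiv.permCongr_apply]
  obtain ⟨⟨α, β⟩, hαβ⟩ := Equiv.Perm.mem_sumCongrHom_range_of_perm_mapsTo_inl he
  refine ⟨α, β, ?_⟩
  have hαβ' : Equiv.sumCongr α β = e := hαβ
  rw [sumPerm, hαβ']
  ext x
  simp [e, Equiv.permCongr_apply]

theorem lehmer_add_eq_iff {n : ℕ} (π : Equiv.Perm (Fin n)) (i : Fin n) :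
    lehmer π i + i + 1 = n ↔ ∀ j, i < j → π j < π i := by
  have h : (Finset.univ.filter fun j : Fin n => i < j ∧ π j < π i) ⊆ Finset.Ioi i :=
    fun j hj => by simp at hj ⊢; exact hj.1
  have hc := Fin.card_Ioi i
  have hi := i.2
  constructor
  · intro he j hj
    have := Finset.eq_of_subset_of_card_le h (by rw [lehmer] at he; omega)
    have hj' := Finset.mem_Ioi.2 hj
    rw [← this] at hj'
    simp at hj'
    exact hj'.2
  · intro hall
    have : (Finset.univ.filter fun j : Fin n => i < j ∧ π j < π i) = Finset.Ioi i := by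
      ext j
      simpa using hall j
    rw [lehmer, this]
    omega

/-- Without such an i the largest value comes last and splits off. Conversely, such an i exceeds all
later entries, so it cannot lie in the left summand of a decomposition; in the right one it forms a
132 with the first and last entries of the whole permutation. -/
theorem indecomposable_iff {n : ℕ} (hn : n ≠ 0) {π : Equiv.Perm (Fin n)}
    (h : ¬ Contains π p132.2) :
    Indecomposable ⟨n, π⟩ ↔ n = 1 ∨ ∃ i, 1 ≤ lehmer π i ∧ lehmer π i + i + 1 = n := by
  constructor
  · intro hind
    by_contra hc
    push Not at hc
    obtain ⟨m, rfl⟩ := Nat.exists_eq_succ_of_ne_zero hn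
    have hlast : π (Fin.last m) = Fin.last m := by
      by_contra hne
      have hi : ∀ j, π.symm (Fin.last m) < j → π j < π (π.symm (Fin.last m)) := by
        intro j hj
        rw [Equiv.apply_symm_apply]
        refine lt_of_le_of_ne (Fin.le_last _) fun e => hj.ne ?_
        rw [← e, Equiv.symm_apply_apply]
      refine hc.2 (π.symm (Fin.last m)) ?_ ((lehmer_add_eq_iff π _).2 hi)
      rw [lehmer_pos_iff]
      have hlt : π.symm (Fin.last m) < Fin.last m := by
        refine lt_of_le_of_ne (Fin.le_last _) fun e => hne ?_
        rw [Equiv.symm_apply_eq] at e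
        exact e.symm
      exact ⟨_, hlt, hi _ hlt⟩
    obtain ⟨α, β, hs⟩ := exists_eq_sumPerm (a := m) (b := 1) π fun i hi => by
      have h1 : π i ≠ Fin.last m := fun e => by
        rw [← hlast] at e
        have := congrArg Fin.val (π.injective e)
        simp at this
        omega
      exact Fin.val_lt_last h1
    have := hind.2 ⟨m, α⟩ ⟨1, β⟩ (by rw [hs]; rfl)
    have := hc.1
    simp at *
    omega
  · rintro (rfl | ⟨i, hi, hin⟩)
    · refine ⟨one_ne_zero, fun σ τ e => ?_⟩
      have : 1 = σ.1 + τ.1 := congrArg Sigma.fst e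
      omega
    · refine ⟨hn, ?_⟩
      rintro ⟨a, α⟩ ⟨b, β⟩ e
      change (⟨n, π⟩ : AnyPerm) = ⟨a + b, sumPerm α β⟩ at e
      cases e
      change a = 0 ∨ b = 0
      by_contra hab
      push Not at hab
      rw [lehmer_add_eq_iff] at hin
      rw [contains_p132_iff] at h
      obtain ⟨j, hij, -⟩ := (lehmer_pos_iff _ i).1 hi
      let z : Fin b := ⟨b - 1, by omega⟩
      have hz : i < Fin.natAdd a z := by
        rw [Fin.lt_def, Fin.val_natAdd]
        have : (i : ℕ) < j := hij
        have := j.2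
        simp only [z]
        omega
      have hz' := hin _ hz
      rw [sumPerm_natAdd] at hz'
      induction i using Fin.addCases with
      | left i =>
        rw [sumPerm_castAdd, Fin.lt_def] at hz'
        simp at hz'
        omega
      | right i =>
        refine h ⟨Fin.castAdd b ⟨0, by omega⟩, Fin.natAdd a i, Fin.natAdd a z, ?_, hz, ?_, ?_⟩
        · rw [Fin.lt_def]; simp; omega
        · rw [sumPerm_castAdd, sumPerm_natAdd, Fin.lt_def]; simp; omega
        · rwa [sumPerm_natAdd]

/-- Used in both directions: equal images under `Lam` force equal lengths of indecomposable
132-avoiders. -/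
theorem length_le_of_Lam_eq {n m : ℕ} {π : Equiv.Perm (Fin n)} {ρ : Equiv.Perm (Fin m)}
    (hm : m ≠ 0) (hn : n ≠ 0) (hπ : Indecomposable ⟨n, π⟩) (h : ¬ Contains π p132.2)
    (e : Lam ⟨n, π⟩ = Lam ⟨m, ρ⟩) : n ≤ m := by
  rcases (indecomposable_iff hn h).1 hπ with rfl | ⟨i, hi, hin⟩
  · omega
  · rw [← Lam_apply, e] at hi hin
    have := Lam_add_lt ρ hi
    omega

theorem bijOn_Lam (k : ℕ) :
    Set.BijOn Lam (indecomposableAvoiders {p132, p2341} k) (SPM k) := by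
  refine ⟨?_, ?_, ?_⟩
  · rintro ⟨n, π⟩ ⟨-, ha, hk⟩
    exact mem_SPM_iff.2 ⟨(avoids_iff_isSandPile π).1 ha, (sum_Lam π).trans hk⟩
  · rintro ⟨n, π⟩ ⟨hi, ha, -⟩ ⟨m, ρ⟩ ⟨hi', ha', -⟩ e
    have hle := length_le_of_Lam_eq hi'.1 hi.1 hi ((avoids_pair_iff _ _ _).1 ha).1 e
    have hle' := length_le_of_Lam_eq hi.1 hi'.1 hi' ((avoids_pair_iff _ _ _).1 ha').1 e.symm
    obtain rfl := hle.antisymm hle'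
    rw [Lam_mk_injective n e]
  · intro l hl
    obtain ⟨hl, hk⟩ := mem_SPM_iff.1 hl
    -- The only possible length: large enough for `l` to be a table, with equality at a positive
    -- entry.
    have main : ∃ n, n ≠ 0 ∧ (∀ i, 1 ≤ l i → l i + i < n) ∧
        (n = 1 ∨ ∃ i, 1 ≤ l i ∧ l i + i + 1 = n) := by
      by_cases hs : l.support.Nonempty
      · obtain ⟨i, hi, hmax⟩ := Finset.exists_max_image l.support (fun i => l i + i) hs
        refine ⟨l i + i + 1, by omega, fun j hj => ?_, Or.inr ⟨i, ?_, rfl⟩⟩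
        · have := hmax j (Finsupp.mem_support_iff.2 (by omega))
          omega
        · have := Finsupp.mem_support_iff.1 hi
          omega
      · refine ⟨1, one_ne_zero, fun j hj => absurd ⟨j, ?_⟩ hs, Or.inl rfl⟩
        exact Finsupp.mem_support_iff.2 (by omega)
    obtain ⟨n, hn, hlt, hmax⟩ := main
    obtain ⟨π, rfl⟩ := exists_Lam_eq hlt
    have ha := (avoids_iff_isSandPile π).2 hl
    refine ⟨⟨n, π⟩, ⟨(indecomposable_iff hn ((avoids_pair_iff _ _ _).1 ha).1).2 ?_, ha,
      (sum_Lam π).symm.trans hk⟩, rfl⟩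
    refine hmax.imp_right ?_
    rintro ⟨i, hi, hin⟩
    refine ⟨⟨i, by omega⟩, ?_⟩
    rw [← Lam_apply]
    exact ⟨hi, hin⟩

/-! ### Counting {132, 2341}-avoiders of large length. -/

theorem add_le_of_antitone {l : ℕ →₀ ℕ} {k : ℕ} (h : Antitone l) (hk : (l.sum fun _ a => a) = k)
    {i : ℕ} (hi : 1 ≤ l i) : l i + i ≤ k := by
  have hsub : Finset.range (i + 1) ⊆ l.support := fun j hj => by
    have := h (Nat.lt_succ_iff.1 (Finset.mem_range.1 hj))
    exact Finsupp.mem_support_iff.2 (by omega)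
  have h1 : ∑ j ∈ Finset.range (i + 1), l j ≤ k := hk ▸ Finset.sum_le_sum_of_subset hsub
  rw [Finset.sum_range_succ] at h1
  have h2 : (Finset.range i).card • 1 ≤ ∑ j ∈ Finset.range i, l j :=
    Finset.card_nsmul_le_sum _ _ _ fun j hj => hi.trans (h (Finset.mem_range.1 hj).le)
  simp at h2
  omega

theorem av_p132_p2341 {n k : ℕ} (h : k < n) : av {p132, p2341} n k = (SPM k).ncard := by
  rw [av, ← Set.ncard_image_of_injective _ (Lam_mk_injective n)]
  congr 1
  ext l
  rw [mem_SPM_iff]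
  constructor
  · rintro ⟨π, ⟨ha, hk⟩, rfl⟩
    exact ⟨(avoids_iff_isSandPile π).1 ha, (sum_Lam π).trans hk⟩
  · rintro ⟨hl, hk⟩
    obtain ⟨π, rfl⟩ := exists_Lam_eq fun i hi => (add_le_of_antitone hl.1 hk hi).trans_lt h
    exact ⟨π, ⟨(avoids_iff_isSandPile π).2 hl, (sum_Lam π).symm.trans hk⟩, rfl⟩


/-! ### The generating function of sand piles, level by level. -/

/-- The members of a family of sequences with given sum. -/
def slice (S : Set (ℕ →₀ ℕ)) (k : ℕ) : Set (ℕ →₀ ℕ) := {l ∈ S | (l.sum fun _ a => a) = k}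

theorem finite_slice {S : Set (ℕ →₀ ℕ)} (hS : ∀ l ∈ S, Antitone l) (k : ℕ) :
    (slice S k).Finite := by
  refine Set.Finite.subset (Finset.finite_toSet
    (Finset.finsuppAntidiag (Finset.range k) k)) ?_
  rintro l ⟨hl, hk⟩
  have hz : ∀ i, k ≤ i → l i = 0 := fun i hi => by
    by_contra h
    have := add_le_of_antitone (hS l hl) hk (Nat.one_le_iff_ne_zero.2 h)
    omega
  have hsub : l.support ⊆ Finset.range k := fun i hi => by
    rw [Finset.mem_range]
    by_contra hN
    exact Finsupp.mem_support_iff.1 hi (hz i (not_lt.1 hN))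
  rw [Finset.mem_coe, Finset.mem_finsuppAntidiag]
  exact ⟨(sum_eq_sum_range hz (fun _ a => a) (by simp)).symm.trans hk, hsub⟩

/-- The generating function of a family of sequences by their sum. -/
noncomputable def genFun (S : Set (ℕ →₀ ℕ)) : PowerSeries ℚ :=
  PowerSeries.mk fun k => ((slice S k).ncard : ℚ)

theorem genFun_union {S T : Set (ℕ →₀ ℕ)} (hS : ∀ l ∈ S, Antitone l) (hT : ∀ l ∈ T, Antitone l)
    (h : Disjoint S T) : genFun (S ∪ T) = genFun S + genFun T := by
  ext k
  simp only [genFun, PowerSeries.coeff_mk, map_add]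
  have e : slice (S ∪ T) k = slice S k ∪ slice T k := by
    ext l
    simp only [slice, Set.mem_union, Set.mem_ofPred_eq]
    tauto
  rw [e, Set.ncard_union_eq (h.mono (fun l hl => hl.1) (fun l hl => hl.1)) (finite_slice hS k)
    (finite_slice hT k)]
  push_cast
  rfl

theorem genFun_image_add (S : Set (ℕ →₀ ℕ)) (v : ℕ →₀ ℕ) :
    genFun ((fun l => l + v) '' S) = PowerSeries.X ^ (v.sum fun _ a => a) * genFun S := by
  have hsum : ∀ l : ℕ →₀ ℕ, ((l + v).sum fun _ a => a) =
      (l.sum fun _ a => a) + v.sum fun _ a => a := fun l =>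
    Finsupp.sum_add_index' (by simp) (by simp)
  ext k
  rw [PowerSeries.coeff_X_pow_mul']
  simp only [genFun, PowerSeries.coeff_mk]
  split_ifs with hk
  · have e : slice ((fun l => l + v) '' S) k =
        (fun l => l + v) '' slice S (k - v.sum fun _ a => a) := by
      ext l
      constructor
      · rintro ⟨⟨l, hl, rfl⟩, h⟩
        exact ⟨l, ⟨hl, by simp only [hsum] at h; omega⟩, rfl⟩
      · rintro ⟨l, ⟨hl, h⟩, rfl⟩
        exact ⟨⟨l, hl, rfl⟩, by simp only [hsum]; omega⟩
    rw [e, Set.ncard_image_of_injective _ (add_left_injective v)]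
  · have e : slice ((fun l => l + v) '' S) k = ∅ := by
      ext l
      simp only [Set.mem_empty_iff_false, iff_false]
      rintro ⟨⟨l, hl, rfl⟩, h⟩
      simp only [hsum] at h
      omega
    rw [e, Set.ncard_empty, Nat.cast_zero]

/-- The sequence of `m` ones. -/
noncomputable def ones (m : ℕ) : ℕ →₀ ℕ :=
  Finsupp.onFinset (Finset.range m) (fun i => if i < m then 1 else 0) (by simp)

theorem ones_apply (m i : ℕ) : ones m i = if i < m then 1 else 0 := rfl

theorem sum_ones (m : ℕ) : ((ones m).sum fun _ a => a) = m := by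
  rw [sum_eq_sum_range (N := m) (fun i hi => by simp [ones_apply, hi]) _ (by simp)]
  rw [Finset.sum_congr rfl fun i hi => by
    rw [ones_apply, if_pos (Finset.mem_range.1 hi)]]
  simp

/-- The sand piles `l` for which the minimum of `l p + p` is `k`. -/
def level (k : ℕ) : Set (ℕ →₀ ℕ) :=
  {l | IsSandPile l ∧ (∀ p, k ≤ l p + p) ∧ ∃ p, l p + p = k}

theorem level_zero : level 0 = {0} := by
  ext l
  rw [Set.mem_singleton_iff]
  constructor
  · rintro ⟨h, -, p, hp⟩
    ext i
    have := h.1 (Nat.zero_le i)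
    obtain rfl : p = 0 := by omega
    simp only [Finsupp.coe_zero, Pi.zero_apply]
    omega
  · rintro rfl
    exact ⟨⟨antitone_const, by simp⟩, by simp, 0, by simp⟩

theorem apply_le_one_of_mem_level {k : ℕ} {l : ℕ →₀ ℕ} (h : l ∈ level k) : l k ≤ 1 := by
  obtain ⟨⟨-, hg⟩, -, p, hp⟩ := h
  rcases lt_trichotomy p k with hpk | rfl | hpk
  · by_contra hc
    have := hg p k hpk (by omega)
    omega
  · omega
  · omega

theorem apply_eq_zero_of_mem_level {k i : ℕ} {l : ℕ →₀ ℕ} (h : l ∈ level k) (hi : k < i) :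
    l i = 0 := by
  obtain ⟨⟨-, hg⟩, -, p, hp⟩ := h
  by_contra hc
  have := hg p i (by omega) (by omega)
  omega

theorem apply_pos_of_mem_level {k i : ℕ} {l : ℕ →₀ ℕ} (h : l ∈ level k) (hi : i < k) :
    1 ≤ l i := by
  have := h.2.1 i
  omega

theorem add_ones_apply_of_lt (l : ℕ →₀ ℕ) {m i : ℕ} (h : i < m) : (l + ones m) i = l i + 1 := by
  rw [Finsupp.add_apply, ones_apply, if_pos h]

theorem add_ones_apply_of_le (l : ℕ →₀ ℕ) {m i : ℕ} (h : m ≤ i) : (l + ones m) i = l i := by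
  rw [Finsupp.add_apply, ones_apply, if_neg h.not_gt, add_zero]

/-- Removing a full column from a sand pile with at most `m` parts leaves a sand pile. -/
theorem isSandPile_of_add_ones {l : ℕ →₀ ℕ} {m : ℕ} (h : IsSandPile (l + ones m))
    (hm : ∀ i, m ≤ i → l i = 0) : IsSandPile l := by
  refine ⟨fun i j hij => ?_, fun p r hpr hr => ?_⟩
  · rcases lt_or_ge j m with hj | hj
    · have := h.1 hij
      rw [add_ones_apply_of_lt l hj, add_ones_apply_of_lt l (hij.trans_lt hj)] at this
      omega
    · rw [hm j hj]; exact Nat.zero_le _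
  · have hrm : r < m := by
      by_contra hc
      have := hm r (not_lt.1 hc)
      omega
    have hp := add_ones_apply_of_lt l (hpr.trans hrm)
    have hr' := add_ones_apply_of_lt l hrm
    have := h.2 p r hpr (by omega)
    omega

/-- Adding a full column of height `m` to a sand pile with at most `m` parts gives a sand pile,
provided that the zeros among the first `m` entries cause no violation. -/
theorem isSandPile_add_ones {l : ℕ →₀ ℕ} {m : ℕ} (h : IsSandPile l) (hm : ∀ i, m ≤ i → l i = 0)
    (hz : ∀ p r, p < r → r < m → l r = 0 → r ≤ l p + p + 1) : IsSandPile (l + ones m) := by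
  refine ⟨fun i j hij => ?_, fun p r hpr hr => ?_⟩
  · rcases lt_or_ge j m with hj | hj
    · have := h.1 hij
      rw [add_ones_apply_of_lt l hj, add_ones_apply_of_lt l (hij.trans_lt hj)]
      omega
    · rw [add_ones_apply_of_le l hj, hm j hj]; exact Nat.zero_le _
  · have hrm : r < m := by
      by_contra hc
      have := hm r (not_lt.1 hc)
      rw [add_ones_apply_of_le l (not_lt.1 hc)] at hr
      omega
    have hp := add_ones_apply_of_lt l (hpr.trans hrm)
    have hr' := add_ones_apply_of_lt l hrm
    rcases Nat.eq_zero_or_pos (l r) with h0 | h0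
    · have := hz p r hpr hrm h0
      omega
    · have := h.2 p r hpr h0
      omega

theorem ones_le {l : ℕ →₀ ℕ} {m : ℕ} (h : ∀ i < m, 1 ≤ l i) : ones m ≤ l := fun i => by
  rw [ones_apply]
  split_ifs with hi
  · exact h i hi
  · exact Nat.zero_le _

/-- Here the entry at k + 1 does not attain the minimum, so the minimum lies within the column of k
+ 2 ones and drops by one when the column is removed. -/
theorem level_one_eq (k : ℕ) :
    {l ∈ level (k + 1) | l (k + 1) = 1} = (fun l => l + ones (k + 2)) '' level k := by
  ext l
  constructor
  · rintro ⟨hl, h1⟩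
    have hle : ones (k + 2) ≤ l :=
      ones_le fun i hi => h1.symm.trans_le (hl.1.1 (by omega))
    obtain ⟨μ, rfl⟩ : ∃ μ, l = μ + ones (k + 2) := ⟨_, (tsub_add_cancel_of_le hle).symm⟩
    have hlt := fun i hi => add_ones_apply_of_lt μ (m := k + 2) (i := i) hi
    have hz : ∀ i, k + 2 ≤ i → μ i = 0 := fun i hi => by
      have := apply_eq_zero_of_mem_level hl (show k + 1 < i by omega)
      rwa [add_ones_apply_of_le μ hi] at this
    refine ⟨μ, ⟨isSandPile_of_add_ones hl.1 hz, fun p => ?_, ?_⟩, rfl⟩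
    · have := hl.2.1 p
      have := hlt p
      omega
    · obtain ⟨p, hp⟩ := hl.2.2
      have := hlt p
      exact ⟨p, by omega⟩
  · rintro ⟨μ, hμ, rfl⟩
    have hz := fun i => apply_eq_zero_of_mem_level (i := i) hμ
    have hlt := fun i hi => add_ones_apply_of_lt μ (m := k + 2) (i := i) hi
    refine ⟨⟨isSandPile_add_ones hμ.1 (fun i hi => hz i (by omega)) fun p r _ hr _ => ?_,
      fun p => ?_, ?_⟩, ?_⟩
    · have := hμ.2.1 p
      omega
    · have := hμ.2.1 p
      have := hlt p
      simp only
      omega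
    · obtain ⟨p, hp⟩ := hμ.2.2
      have := hlt p
      refine ⟨p, ?_⟩
      simp only
      omega
    · have := hlt (k + 1) (by omega)
      have := hz (k + 1) (by omega)
      simp only
      omega

theorem level_zero_eq (k : ℕ) :
    {l ∈ level (k + 1) | l (k + 1) = 0} =
      (fun l => l + ones (k + 1)) '' ({l ∈ level (k + 1) | l (k + 1) = 0} ∪ level k) := by
  ext l
  constructor
  · rintro ⟨hl, h1⟩
    have hle : ones (k + 1) ≤ l := ones_le fun i hi => apply_pos_of_mem_level hl hi
    obtain ⟨μ, rfl⟩ : ∃ μ, l = μ + ones (k + 1) := ⟨_, (tsub_add_cancel_of_le hle).symm⟩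
    have hlt := fun i hi => add_ones_apply_of_lt μ (m := k + 1) (i := i) hi
    have hz : ∀ i, k + 1 ≤ i → μ i = 0 := fun i hi => by
      have := hl.1.1 hi
      rwa [h1, add_ones_apply_of_le μ hi, Nat.le_zero] at this
    have hs := isSandPile_of_add_ones hl.1 hz
    refine ⟨μ, ?_, rfl⟩
    -- Removing the column lowers `l p + p` only for p ≤ k. The minimum drops to k if it was
    -- attained there; otherwise position k + 1 alone attained it and still attains k + 1.
    by_cases hp : ∃ p ≤ k, (μ + ones (k + 1)) p + p = k + 1
    · obtain ⟨p, hpk, hp⟩ := hp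
      refine Or.inr ⟨hs, fun q => ?_, p, ?_⟩
      · have := hl.2.1 q
        have := hlt q
        omega
      · have := hlt p
        omega
    · push Not at hp
      refine Or.inl ⟨⟨hs, fun q => ?_, k + 1, ?_⟩, hz _ le_rfl⟩
      · have := hl.2.1 q
        have := hlt q
        have := hp q
        omega
      · rw [hz _ le_rfl, zero_add]
  · rintro ⟨μ, hμ, rfl⟩
    have hlt := fun i hi => add_ones_apply_of_lt μ (m := k + 1) (i := i) hi
    have hge := fun i hi => add_ones_apply_of_le μ (m := k + 1) (i := i) hi
    have hs : IsSandPile μ := hμ.elim (fun h => h.1.1) fun h => h.1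
    have hmin : ∀ p, k ≤ μ p + p := hμ.elim (fun h p => by have := h.1.2.1 p; omega) fun h => h.2.1
    have hz : ∀ i, k + 1 ≤ i → μ i = 0 := by
      intro i hi
      rcases hμ with h | h
      · have := h.1.1.1 hi
        rwa [h.2, Nat.le_zero] at this
      · exact apply_eq_zero_of_mem_level h hi
    refine ⟨⟨isSandPile_add_ones hs hz fun p r _ hr _ => ?_, fun p => ?_, k + 1, ?_⟩, ?_⟩
    · have := hmin p
      omega
    · have := hmin p
      have := hlt p
      simp only
      omega
    · simp only
      rw [hge _ le_rfl, hz _ le_rfl, zero_add]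
    · simp only
      rw [hge _ le_rfl, hz _ le_rfl]

/-- Let L be the series of level k and B that of the piles of level k + 1 vanishing at k + 1. Then B
= x^(k+1) (B + L), and the other piles contribute x^(k+2) L; solving for B gives the factor. -/
theorem genFun_level_succ (k : ℕ) :
    genFun (level (k + 1)) = PowerSeries.X ^ (k + 1) *
      (PowerSeries.X + (1 - PowerSeries.X ^ (k + 1))⁻¹) * genFun (level k) := by
  have hB : ∀ l ∈ {l ∈ level (k + 1) | l (k + 1) = 0}, Antitone l := fun l hl => hl.1.1.1
  have hC : ∀ l ∈ {l ∈ level (k + 1) | l (k + 1) = 1}, Antitone l := fun l hl => hl.1.1.1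
  have h1 : genFun (level (k + 1)) = genFun {l ∈ level (k + 1) | l (k + 1) = 0} +
      genFun {l ∈ level (k + 1) | l (k + 1) = 1} := by
    rw [← genFun_union hB hC]
    · congr 1
      ext l
      simp only [Set.mem_union, Set.mem_ofPred_eq, ← and_or_left]
      refine ⟨fun h => ⟨h, ?_⟩, fun h => h.1⟩
      have := apply_le_one_of_mem_level h
      omega
    · rw [Set.disjoint_left]
      rintro l ⟨-, h⟩ ⟨-, h'⟩
      omega
  have h2 : genFun {l ∈ level (k + 1) | l (k + 1) = 0} = PowerSeries.X ^ (k + 1) *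
      (genFun {l ∈ level (k + 1) | l (k + 1) = 0} + genFun (level k)) := by
    rw [← genFun_union hB fun l hl => hl.1.1]
    · conv_lhs => rw [level_zero_eq, genFun_image_add, sum_ones]
    · rw [Set.disjoint_left]
      rintro l ⟨h, -⟩ h'
      obtain ⟨p, hp⟩ := h'.2.2
      have := h.2.1 p
      omega
  have h3 : genFun {l ∈ level (k + 1) | l (k + 1) = 1} =
      PowerSeries.X ^ (k + 2) * genFun (level k) := by
    rw [level_one_eq, genFun_image_add, sum_ones]
  have h4 : (1 - PowerSeries.X ^ (k + 1) : PowerSeries ℚ)⁻¹ *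
      (1 - PowerSeries.X ^ (k + 1)) = 1 := PowerSeries.inv_mul_cancel _ (by simp)
  rw [h1, h3]
  linear_combination (1 - PowerSeries.X ^ (k + 1) : PowerSeries ℚ)⁻¹ * h2 -
    genFun {l ∈ level (k + 1) | l (k + 1) = 0} * h4

theorem genFun_level (k : ℕ) : genFun (level k) = spmTerm k := by
  induction k with
  | zero =>
    rw [level_zero]
    ext n
    simp only [genFun, PowerSeries.coeff_mk, spmTerm, zero_mul, Nat.zero_div, pow_zero, one_mul]
    rw [Finset.Icc_eq_empty (by omega), Finset.prod_empty, PowerSeries.coeff_one]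
    split_ifs with hn
    · have : slice {0} n = {0} := by
        ext l
        simp only [slice, Set.mem_singleton_iff, Set.mem_ofPred_eq]
        constructor
        · exact fun h => h.1
        · rintro rfl
          simp [hn]
      rw [this, Set.ncard_singleton, Nat.cast_one]
    · have : slice {0} n = ∅ := by
        ext l
        simp only [slice, Set.mem_singleton_iff, Set.mem_ofPred_eq, Set.mem_empty_iff_false,
          iff_false]
        rintro ⟨rfl, h⟩
        simp at h
        omega
      rw [this, Set.ncard_empty, Nat.cast_zero]
  | succ k ih =>
    have e : (k + 1) * (k + 1 + 1) / 2 = k * (k + 1) / 2 + (k + 1) := by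
      rw [show (k + 1) * (k + 1 + 1) = k * (k + 1) + (k + 1) * 2 by ring,
        Nat.add_mul_div_right _ _ two_pos]
    rw [genFun_level_succ, ih, spmTerm, spmTerm, Finset.prod_Icc_succ_top (by omega), e, pow_add]
    ring

theorem le_of_mem_slice_level {k n : ℕ} {l : ℕ →₀ ℕ} (h : l ∈ slice (level k) n) : k ≤ n := by
  rcases Nat.eq_zero_or_pos k with rfl | hk
  · exact Nat.zero_le _
  · have := add_le_of_antitone h.1.1.1 h.2 (apply_pos_of_mem_level h.1 (Nat.sub_one_lt hk.ne'))
    have := apply_pos_of_mem_level h.1 (Nat.sub_one_lt hk.ne')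
    omega

/-- The levels partition the sand piles, and a pile of n has level at most n, since its first k
entries are positive at level k. -/
theorem ncard_SPM (n : ℕ) :
    (SPM n).ncard = ∑ k ∈ Finset.range (n + 1), (slice (level k) n).ncard := by
  have e : SPM n = ⋃ k ∈ Finset.range (n + 1), slice (level k) n := by
    ext l
    simp only [Set.mem_iUnion, exists_prop, mem_SPM_iff]
    constructor
    · rintro ⟨hl, hn⟩
      have hex : ∃ k, ∃ p, l p + p = k := ⟨_, 0, rfl⟩
      classical
      have hmem : l ∈ slice (level (Nat.find hex)) n :=
        ⟨⟨hl, fun p => Nat.find_min' hex ⟨p, rfl⟩, Nat.find_spec hex⟩, hn⟩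
      exact ⟨_, Finset.mem_range_succ_iff.2 (le_of_mem_slice_level hmem), hmem⟩
    · rintro ⟨k, -, hl, hn⟩
      exact ⟨hl.1, hn⟩
  have hdisj : (Set.PairwiseDisjoint (↑(Finset.range (n + 1))) fun k => slice (level k) n) := by
    intro k _ k' _ hkk'
    refine Set.disjoint_left.2 fun l h h' => hkk' ?_
    obtain ⟨p, hp⟩ := h.1.2.2
    obtain ⟨p', hp'⟩ := h'.1.2.2
    have h1 := h.1.2.1 p'
    have h2 := h'.1.2.1 p
    omega
  rw [e, ← finsum_mem_coe_finset]
  exact (Finset.finite_toSet _).ncard_biUnion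
    (fun k _ => finite_slice (fun l hl => hl.1.1) n) hdisj

theorem hasSum_spmTerm :
    HasSum spmTerm (PowerSeries.mk fun n => ((SPM n).ncard : ℚ)) := by
  rw [PowerSeries.WithPiTopology.hasSum_iff_hasSum_coeff]
  intro n
  rw [PowerSeries.coeff_mk, ncard_SPM, Nat.cast_sum]
  have : ∀ k, PowerSeries.coeff n (spmTerm k) = ((slice (level k) n).ncard : ℚ) := fun k => by
    rw [← genFun_level, genFun, PowerSeries.coeff_mk]
  simp only [this]
  refine hasSum_sum_of_ne_finset_zero fun k hk => ?_
  have : slice (level k) n = ∅ := by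
    ext l
    simp only [Set.mem_empty_iff_false, iff_false]
    intro hl
    exact hk (Finset.mem_range_succ_iff.2 (le_of_mem_slice_level hl))
  rw [this, Set.ncard_empty, Nat.cast_zero]

theorem summable_spmTerm_succ : Summable fun k : ℕ => spmTerm (k + 1) :=
  (summable_nat_add_iff 1).2 hasSum_spmTerm.summable

theorem spmSeries_eq : spmSeries = PowerSeries.mk fun n => ((SPM n).ncard : ℚ) := by
  rw [← hasSum_spmTerm.tsum_eq, hasSum_spmTerm.summable.tsum_eq_zero_add, spmSeries]
  congr 1
  simp [spmTerm]


/-! ### The symmetry exchanging 132 and 213. -/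

/-- The inverse of the reverse complement of a permutation. -/
def invRevCompl {n : ℕ} (π : Equiv.Perm (Fin n)) : Equiv.Perm (Fin n) :=
  (Fin.revPerm.trans π.symm).trans Fin.revPerm

theorem invRevCompl_apply {n : ℕ} (π : Equiv.Perm (Fin n)) (i : Fin n) :
    invRevCompl π i = Fin.rev (π.symm (Fin.rev i)) := rfl

theorem invRevCompl_invRevCompl {n : ℕ} (π : Equiv.Perm (Fin n)) :
    invRevCompl (invRevCompl π) = π := by
  ext i
  have : (invRevCompl π).symm (Fin.rev i) = Fin.rev (π i) := by
    rw [Equiv.symm_apply_eq, invRevCompl_apply]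
    simp
  rw [invRevCompl_apply, this, Fin.rev_rev]

theorem inv_invRevCompl {n : ℕ} (π : Equiv.Perm (Fin n)) : inv (invRevCompl π) = inv π := by
  symm
  -- Inversion swaps the order of the two positions and reversal restores it, so the pair keeps its
  -- orientation.
  refine Finset.card_nbij' (fun q => (Fin.rev (π q.1), Fin.rev (π q.2)))
    (fun q => (π.symm (Fin.rev q.1), π.symm (Fin.rev q.2))) ?_ ?_ ?_ ?_
  · rintro ⟨i, j⟩ h
    simpa [invRevCompl_apply, and_comm] using h
  · rintro ⟨i, j⟩ h
    simpa [invRevCompl_apply, and_comm] using h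
  · rintro ⟨i, j⟩ _
    simp
  · rintro ⟨i, j⟩ _
    simp

theorem contains_invRevCompl {n m : ℕ} {π : Equiv.Perm (Fin n)} {p : Equiv.Perm (Fin m)}
    (h : Contains π p) : Contains (invRevCompl π) (invRevCompl p) := by
  obtain ⟨f, hf⟩ := h
  refine ⟨OrderEmbedding.ofStrictMono (fun i => Fin.rev (π (f (p.symm (Fin.rev i))))) ?_, ?_⟩
  · intro i j hij
    rw [Fin.rev_lt_rev, hf]
    simpa using hij
  · intro i j
    change invRevCompl π (Fin.rev (π _)) < invRevCompl π (Fin.rev (π _)) ↔ _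
    simp [invRevCompl_apply]

theorem contains_invRevCompl_iff {n m : ℕ} {π : Equiv.Perm (Fin n)} {p : Equiv.Perm (Fin m)} :
    Contains (invRevCompl π) p ↔ Contains π (invRevCompl p) :=
  ⟨fun h => by simpa only [invRevCompl_invRevCompl] using contains_invRevCompl h,
    fun h => by simpa only [invRevCompl_invRevCompl] using contains_invRevCompl h⟩

theorem invRevCompl_p213 : invRevCompl p213.2 = p132.2 := by
  ext i; fin_cases i <;> rfl

theorem invRevCompl_p2341 : invRevCompl p2341.2 = p2341.2 := by
  ext i; fin_cases i <;> rfl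

theorem av_p213_p2341 (n k : ℕ) : av {p213, p2341} n k = av {p132, p2341} n k := by
  have hinj : Function.Injective (invRevCompl : Equiv.Perm (Fin n) → _) :=
    (show Function.Involutive invRevCompl from invRevCompl_invRevCompl).injective
  rw [av, av, ← Set.ncard_image_of_injective _ hinj]
  congr 1
  have key : ∀ π : Equiv.Perm (Fin n),
      Avoids (invRevCompl π) {p213, p2341} ↔ Avoids π {p132, p2341} := fun π => by
    rw [avoids_pair_iff, avoids_pair_iff, contains_invRevCompl_iff, contains_invRevCompl_iff,
      invRevCompl_p2341]
    erw [invRevCompl_p213]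
    rfl
  ext π
  constructor
  · rintro ⟨ρ, ⟨ha, hk⟩, rfl⟩
    refine ⟨?_, (inv_invRevCompl ρ).trans hk⟩
    rwa [← key, invRevCompl_invRevCompl]
  · rintro ⟨ha, hk⟩
    exact ⟨invRevCompl π, ⟨(key π).2 ha, (inv_invRevCompl π).trans hk⟩,
      invRevCompl_invRevCompl π⟩

/-! ### Direct sums and {1324, 2341}-avoiders. -/

theorem sumPerm_injective (a b : ℕ) : Function.Injective
    fun q : Equiv.Perm (Fin a) × Equiv.Perm (Fin b) => sumPerm q.1 q.2 := by
  rintro ⟨α, β⟩ ⟨α', β'⟩ h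
  refine Prod.ext (Equiv.ext fun i => ?_) (Equiv.ext fun i => ?_)
  · have := DFunLike.congr_fun h (Fin.castAdd b i)
    simpa [sumPerm_castAdd] using this
  · have := DFunLike.congr_fun h (Fin.natAdd a i)
    simpa [sumPerm_natAdd] using this

theorem inv_sumPerm {a b : ℕ} (α : Equiv.Perm (Fin a)) (β : Equiv.Perm (Fin b)) :
    inv (sumPerm α β) = inv α + inv β := by
  simp only [inv_eq_sum_lehmer, Fin.sum_univ_add]
  congr 1
  · refine Finset.sum_congr rfl fun i _ => ?_
    have : ∀ j : Fin b, ¬ a + (β j : ℕ) < α i := fun j => by omega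
    simp only [lehmer, Finset.card_filter, Fin.sum_univ_add, sumPerm_castAdd, sumPerm_natAdd,
      Fin.lt_def, Fin.val_castAdd, Fin.val_natAdd, this]
    simp
  · refine Finset.sum_congr rfl fun i _ => ?_
    have : ∀ j : Fin a, ¬ a + (i : ℕ) < j := fun j => by omega
    simp only [lehmer, Finset.card_filter, Fin.sum_univ_add, sumPerm_castAdd, sumPerm_natAdd,
      Fin.lt_def, Fin.val_castAdd, Fin.val_natAdd, this]
    simp

theorem contains_p2341_sumPerm_iff {a b : ℕ} (α : Equiv.Perm (Fin a)) (β : Equiv.Perm (Fin b)) :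
    Contains (sumPerm α β) p2341.2 ↔ Contains α p2341.2 ∨ Contains β p2341.2 := by
  simp only [contains_p2341_iff]
  constructor
  · rintro ⟨w, x, y, z, h1, h2, h3, h4, h5, h6⟩
    induction w using Fin.addCases <;> induction x using Fin.addCases <;>
      induction y using Fin.addCases <;> induction z using Fin.addCases <;>
      simp only [sumPerm_castAdd, sumPerm_natAdd, Fin.lt_def, Fin.val_castAdd,
        Fin.val_natAdd] at h1 h2 h3 h4 h5 h6 <;> first
      | omega
      | exact Or.inl ⟨_, _, _, _, h1, h2, h3, h4, h5, h6⟩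
      | exact Or.inr ⟨_, _, _, _, Nat.lt_of_add_lt_add_left h1, Nat.lt_of_add_lt_add_left h2,
          Nat.lt_of_add_lt_add_left h3, Nat.lt_of_add_lt_add_left h4,
          Nat.lt_of_add_lt_add_left h5, Nat.lt_of_add_lt_add_left h6⟩
  · rintro (⟨w, x, y, z, h⟩ | ⟨w, x, y, z, h⟩)
    · refine ⟨Fin.castAdd b w, Fin.castAdd b x, Fin.castAdd b y, Fin.castAdd b z, ?_⟩
      simp only [sumPerm_castAdd, Fin.lt_def, Fin.val_castAdd] at h ⊢
      omega
    · refine ⟨Fin.natAdd a w, Fin.natAdd a x, Fin.natAdd a y, Fin.natAdd a z, ?_⟩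
      simp only [sumPerm_natAdd, Fin.lt_def, Fin.val_natAdd] at h ⊢
      omega

/-- The inversion 32 of an occurrence lies in one summand. If it is the left one, so does the 1,
giving a 132; if the right one, so does the 4, giving a 213. Conversely, any entry of the other
summand supplies the missing 4 or 1, which is why both must be nonempty. -/
theorem contains_p1324_sumPerm_iff {a b : ℕ} (ha : 0 < a) (hb : 0 < b)
    (α : Equiv.Perm (Fin a)) (β : Equiv.Perm (Fin b)) :
    Contains (sumPerm α β) p1324.2 ↔ Contains α p132.2 ∨ Contains β p213.2 := by
  simp only [contains_p1324_iff, contains_p132_iff, contains_p213_iff]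
  constructor
  · rintro ⟨w, x, y, z, h1, h2, h3, h4, h5, h6⟩
    induction w using Fin.addCases <;> induction x using Fin.addCases <;>
      induction y using Fin.addCases <;> induction z using Fin.addCases <;>
      simp only [sumPerm_castAdd, sumPerm_natAdd, Fin.lt_def, Fin.val_castAdd,
        Fin.val_natAdd] at h1 h2 h3 h4 h5 h6 <;> first
      | omega
      | exact Or.inl ⟨_, _, _, h1, h2, h4, h5⟩
      | exact Or.inr ⟨_, _, _, Nat.lt_of_add_lt_add_left h2, Nat.lt_of_add_lt_add_left h3,
          Nat.lt_of_add_lt_add_left h5, Nat.lt_of_add_lt_add_left h6⟩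
  · rintro (⟨x, y, z, h1, h2, h3, h4⟩ | ⟨x, y, z, h1, h2, h3, h4⟩)
    · refine ⟨Fin.castAdd b x, Fin.castAdd b y, Fin.castAdd b z, Fin.natAdd a ⟨0, hb⟩, ?_⟩
      simp only [sumPerm_castAdd, sumPerm_natAdd, Fin.lt_def, Fin.val_castAdd, Fin.val_natAdd]
      omega
    · refine ⟨Fin.castAdd b ⟨0, ha⟩, Fin.natAdd a x, Fin.natAdd a y, Fin.natAdd a z, ?_⟩
      simp only [sumPerm_castAdd, sumPerm_natAdd, Fin.lt_def, Fin.val_castAdd, Fin.val_natAdd]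
      omega

theorem avoids_sumPerm_iff {a b : ℕ} (ha : 0 < a) (hb : 0 < b)
    (α : Equiv.Perm (Fin a)) (β : Equiv.Perm (Fin b)) :
    Avoids (sumPerm α β) {p1324, p2341} ↔
      Avoids α {p132, p2341} ∧ Avoids β {p213, p2341} := by
  simp only [avoids_pair_iff, contains_p1324_sumPerm_iff ha hb, contains_p2341_sumPerm_iff]
  tauto

theorem card_le_inv {n : ℕ} (π : Equiv.Perm (Fin n)) (s : Finset (Fin n))
    (f : Fin n → Fin n × Fin n) (hf : ∀ p ∈ s, (f p).1 < (f p).2 ∧ π (f p).2 < π (f p).1)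
    (hinj : Set.InjOn f s) : s.card ≤ inv π :=
  Finset.card_le_card_of_injOn f (fun p hp => by simpa using hf p hp) hinj

/-- A `1324`-avoider with few inversions preserves every initial segment far from the ends. -/
theorem apply_lt_of_not_contains_p1324 {n m : ℕ} {π : Equiv.Perm (Fin n)}
    (h : ¬ Contains π p1324.2) (hm : inv π < m) (hn : inv π + m < n) (i : Fin n)
    (hi : (i : ℕ) < m) : (π i : ℕ) < m := by
  by_contra hmi
  rw [not_lt] at hmi
  obtain ⟨j, hj, hmj⟩ : ∃ j : Fin n, m ≤ j ∧ (π j : ℕ) < m := by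
    by_contra hc
    push Not at hc
    -- Pigeonhole: if no position from m on had a value below m, these positions would already use
    -- up all values from m on, leaving none for i.
    let S : Finset (Fin n) := Finset.univ.filter fun x => m ≤ x
    have hS : S.image π = S := by
      refine Finset.eq_of_subset_of_card_le (fun x hx => ?_) ?_
      · obtain ⟨y, hy, rfl⟩ := Finset.mem_image.1 hx
        simp only [S, Finset.mem_filter, Finset.mem_univ, true_and] at hy ⊢
        exact hc y hy
      · rw [Finset.card_image_of_injective _ π.injective]
    have hiS : π i ∈ S.image π := by
      rw [hS]
      simpa [S] using hmi
    obtain ⟨y, hy, he⟩ := Finset.mem_image.1 hiS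
    rw [π.injective he] at hy
    simp only [S, Finset.mem_filter, Finset.mem_univ, true_and] at hy
    omega
  have hij : i < j := by rw [Fin.lt_def]; omega
  have hπ : π j < π i := by rw [Fin.lt_def]; omega
  rw [contains_p1324_iff] at h
  by_cases hA : ∃ x, x < i ∧ π x < π j
  · by_cases hB : ∃ y, j < y ∧ π i < π y
    · obtain ⟨x, hx, hx'⟩ := hA
      obtain ⟨y, hy, hy'⟩ := hB
      exact h ⟨x, i, j, y, hx, hij, hy, hx', hπ, hy'⟩
    · push Not at hB
      -- With no 4 available, each p after i forms an inversion with i or, being above π i and hence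
      -- before j, with j. That makes at least n - m inversions.
      have := card_le_inv π (Finset.Ioi i) (fun p => if π p < π i then (i, p) else (p, j)) ?_ ?_
      · rw [Fin.card_Ioi] at this
        omega
      · intro p hp
        rw [Finset.mem_Ioi] at hp
        split_ifs with hlt
        · exact ⟨hp, hlt⟩
        · have h1 : π i ≤ π p := not_lt.1 hlt
          refine ⟨?_, hπ.trans_le h1⟩
          change p < j
          by_contra hjp
          rcases (not_lt.1 hjp).eq_or_lt with e | e
          · rw [e] at hπ
            exact hlt hπ
          · exact hp.ne' (π.injective ((hB p e).antisymm h1))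
      · intro p hp q hq e
        simp only [Finset.coe_Ioi, Set.mem_Ioi] at hp hq
        simp only at e
        split_ifs at e <;> simp only [Prod.mk.injEq] at e
        · exact e.2
        · exact absurd e.1 hq.ne
        · exact absurd e.1.symm hp.ne
        · exact e.1
  · push Not at hA
    -- With no 1 available, symmetrically, each of the at least m positions before j forms an
    -- inversion with j or i.
    have := card_le_inv π (Finset.Iio j) (fun p => if π j < π p then (p, j) else (i, p)) ?_ ?_
    · rw [Fin.card_Iio] at this
      omega
    · intro p hp
      rw [Finset.mem_Iio] at hp
      split_ifs with hlt
      · exact ⟨hp, hlt⟩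
      · have h1 : π p ≤ π j := not_lt.1 hlt
        refine ⟨?_, h1.trans_lt hπ⟩
        change i < p
        by_contra hip
        rcases (not_lt.1 hip).eq_or_lt with e | e
        · rw [← e] at hπ
          exact hlt hπ
        · exact hp.ne (π.injective (h1.antisymm (hA p e)))
    · intro p hp q hq e
      simp only [Finset.coe_Iio, Set.mem_Iio] at hp hq
      simp only at e
      split_ifs at e <;> simp only [Prod.mk.injEq] at e
      · exact e.1
      · exact absurd e.2.symm hq.ne
      · exact absurd e.2 hp.ne
      · exact e.2

theorem av_p1324_p2341 {n k : ℕ} (h : 2 * k + 2 ≤ n) :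
    av {p1324, p2341} n k =
      ∑ q ∈ Finset.HasAntidiagonal.antidiagonal k, (SPM q.1).ncard * (SPM q.2).ncard := by
  -- Cutting at k + 1 leaves both blocks longer than k, so each is in the range where
  -- `av_p132_p2341` applies.
  obtain ⟨b, rfl⟩ : ∃ b, n = k + 1 + b := ⟨n - (k + 1), by omega⟩
  let A : ℕ → Set (Equiv.Perm (Fin (k + 1))) := fun i => {α | Avoids α {p132, p2341} ∧ inv α = i}
  let B : ℕ → Set (Equiv.Perm (Fin b)) := fun j => {β | Avoids β {p213, p2341} ∧ inv β = j}
  have hsplit : {π : Equiv.Perm (Fin (k + 1 + b)) | Avoids π {p1324, p2341} ∧ inv π = k} =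
      (fun q : Equiv.Perm (Fin (k + 1)) × Equiv.Perm (Fin b) => sumPerm q.1 q.2) ''
        ⋃ q ∈ Finset.HasAntidiagonal.antidiagonal k, A q.1 ×ˢ B q.2 := by
    ext π
    simp only [Set.mem_image, Set.mem_iUnion, exists_prop, Prod.exists, Set.mem_prod,
      Finset.HasAntidiagonal.mem_antidiagonal]
    constructor
    · rintro ⟨ha, hk⟩
      obtain ⟨α, β, rfl⟩ := exists_eq_sumPerm π
        (apply_lt_of_not_contains_p1324 ((avoids_pair_iff _ _ _).1 ha).1 (by omega) (by omega))
      rw [avoids_sumPerm_iff (by omega) (by omega)] at ha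
      exact ⟨α, β, ⟨inv α, inv β, (inv_sumPerm α β).symm.trans hk, ⟨ha.1, rfl⟩, ha.2, rfl⟩, rfl⟩
    · rintro ⟨α, β, ⟨i, j, hk, ⟨ha, rfl⟩, hb, rfl⟩, rfl⟩
      exact ⟨(avoids_sumPerm_iff (by omega) (by omega) α β).2 ⟨ha, hb⟩,
        (inv_sumPerm α β).trans hk⟩
  have hdisj : Set.PairwiseDisjoint (↑(Finset.HasAntidiagonal.antidiagonal k))
      fun q : ℕ × ℕ => A q.1 ×ˢ B q.2 := by
    rintro q _ q' _ hne
    refine Set.disjoint_left.2 ?_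
    rintro ⟨α, β⟩ ⟨h1, h2⟩ ⟨h1', h2'⟩
    exact hne (Prod.ext (h1.2.symm.trans h1'.2) (h2.2.symm.trans h2'.2))
  rw [av, hsplit, Set.ncard_image_of_injective _ (sumPerm_injective _ _)]
  refine ((Finset.finite_toSet _).ncard_biUnion (fun _ _ => Set.toFinite _) hdisj).trans ?_
  rw [finsum_mem_coe_finset]
  refine Finset.sum_congr rfl fun q hq => ?_
  rw [Finset.HasAntidiagonal.mem_antidiagonal] at hq
  rw [Set.ncard_prod, ← av_p132_p2341 (n := k + 1) (by omega),
    ← av_p132_p2341 (n := b) (k := q.2) (by omega), ← av_p213_p2341 b]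
  rfl

end PermPattern

theorem proposition7p2 :
    (∀ k : ℕ, Set.BijOn PermPattern.Lam
      (PermPattern.indecomposableAvoiders {PermPattern.p132, PermPattern.p2341} k)
      (PermPattern.SPM k)) ∧
    Summable (fun k : ℕ => PermPattern.spmTerm (k + 1)) ∧
    PermPattern.IsLimitGenFun {PermPattern.p132, PermPattern.p2341} PermPattern.spmSeries ∧
    PermPattern.IsLimitGenFun {PermPattern.p1324, PermPattern.p2341}
      (PermPattern.spmSeries ^ 2) := by
  refine ⟨PermPattern.bijOn_Lam, PermPattern.summable_spmTerm_succ,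
    ⟨fun k => (PermPattern.SPM k).ncard,
      fun k => ⟨k + 1, fun n hn => PermPattern.av_p132_p2341 hn⟩, PermPattern.spmSeries_eq⟩,
    ⟨fun k => ∑ q ∈ Finset.HasAntidiagonal.antidiagonal k,
      (PermPattern.SPM q.1).ncard * (PermPattern.SPM q.2).ncard,
      fun k => ⟨2 * k + 2, fun n hn => PermPattern.av_p1324_p2341 hn⟩, ?_⟩⟩
  ext n
  rw [PermPattern.spmSeries_eq, pow_two, PowerSeries.coeff_mul]
  simp only [PowerSeries.coeff_mk, Nat.cast_sum, Nat.cast_mul]
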